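/- Let $P$ be a convex polytope in $\mathbb{R}^d$ with exactly $r$ vertices. Points $p_1,\dots,p_N\in\mathbb{R}^d$ *can be $P$-partitioned* if $\{1,\dots,N\}$ can be partitioned into classes $A_1,\dots,A_r$ for which there are points $x_i\in\operatorname{Conv}\{p_j : j\in A_i\}$ $(1\le i\le r)$ such that $\{x_1,\dots,x_r\}$ is the vertex set of $P$. Two polytopes are *similar* if one is carried onto the other by a uniform scaling with positive factor followed by an isometry of $\mathbb{R}^d$. A property holds for a *generic* set of $N$ points in $\mathbb{R}^d$ if it holds for all $N$-tuples in some dense open subset of $(\mathbb{R}^d)^N$ of full Lebesgue measure. Let $N_P\in\mathbb{N}\cup\{\infty\}$ be the minimum number $N$ such that a generic set of $N$ points in $\mathbb{R}^d$ can be $Q$-partitioned by some polytope $Q$ (depending on the points) similar to $P$, with $N_P=\infty$ if there is no such $N$. **Theorem 1.3.** Let $P_{\{3,3,4\}}$, $P_{\{3,4,3\}}$ and $P_{\{3,3,5\}}$ denote the regular 4-dimensional cross-polytope, the regular 24-cell and the regular 600-cell in $\mathbb{R}^4$, in their standard positions. That is, $P_{\{3,3,4\}}$ is the convex hull of the 8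 points $\pm e_1,\dots,\pm e_4$; $P_{\{3,4,3\}}$ is the convex hull of these points and the 16 points $\tfrac12(\pm1,\pm1,\pm1,\pm1)$; and $P_{\{3,3,5\}}$ is the convex hull of these 24 points and the 96 points obtained from $\tfrac12(\pm\varphi,\pm1,\pm\varphi^{-1},0)$, $\varphi=\tfrac{1+\sqrt5}{2}$, by even permutations of the coordinates. Then (a) $N_{P_{\{3,3,4\}}}\le 32$, (b) $N_{P_{\{3,4,3\}}}\le 112$, and (c) $N_{P_{\{3,3,5\}}}\le 592$. -/

import Mathlib

/-- Two subsets of `ℝ^d` are similar if one is carried onto the other by a uniform scaling with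
positive factor followed by an isometry of `ℝ^d`. -/
def AreSimilar {d : ℕ} (P Q : Set (EuclideanSpace ℝ (Fin d))) : Prop :=
  ∃ (φ : EuclideanSpace ℝ (Fin d) ≃ᵢ EuclideanSpace ℝ (Fin d)) (c : ℝ),
    0 < c ∧ Q = (fun x => φ (c • x)) '' P

/-- The points `p 0, …, p (N - 1)` can be `P`-partitioned: they can be divided into pairwise
disjoint classes `A 0, …, A (r - 1)` (sets of indices) such that there are `r` distinct points, one
in the convex hull of each class, which together are exactly the vertices (the extreme points)
of `P`. So `r` is the number of vertices of `P`. -/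
def CanBePartitioned {d N : ℕ} (P : Set (EuclideanSpace ℝ (Fin d)))
    (p : Fin N → EuclideanSpace ℝ (Fin d)) : Prop :=
  ∃ (r : ℕ) (A : Fin r → Set (Fin N)) (x : Fin r → EuclideanSpace ℝ (Fin d)),
    Pairwise (fun i j => Disjoint (A i) (A j)) ∧
    (⋃ i, A i) = Set.univ ∧
    (∀ i, x i ∈ convexHull ℝ (p '' A i)) ∧
    Function.Injective x ∧
    Set.range x = Set.extremePoints ℝ P

/-- A property of `N`-tuples of points of `ℝ^d` holds generically if it holds at all members of
a dense open subset of `(ℝ^d)^N` of full Lebesgue measure. -/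
def HoldsGenerically {d N : ℕ} (Q : (Fin N → EuclideanSpace ℝ (Fin d)) → Prop) : Prop :=
  ∃ U : Set (Fin N → EuclideanSpace ℝ (Fin d)),
    IsOpen U ∧ Dense U ∧ MeasureTheory.volume Uᶜ = 0 ∧ ∀ p ∈ U, Q p

/-- The least `N` for which a generic `N`-tuple of points of `ℝ^d` can be partitioned by some
polytope similar to `P`; it is `⊤` if there is no such `N`. -/
noncomputable def partitionNumber {d : ℕ} (P : Set (EuclideanSpace ℝ (Fin d))) : ℕ∞ :=
  sInf ((fun N : ℕ => (N : ℕ∞)) '' {N : ℕ | HoldsGenerically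
    (fun p : Fin N → EuclideanSpace ℝ (Fin d) => ∃ Q, AreSimilar P Q ∧ CanBePartitioned Q p)})

/-- The 8 points `± e_i` of `ℝ⁴`. -/
def axisPoints : Set (EuclideanSpace ℝ (Fin 4)) :=
  {x | ∃ i, x = EuclideanSpace.single i 1 ∨ x = EuclideanSpace.single i (-1)}

/-- The 16 points `(±1/2, ±1/2, ±1/2, ±1/2)` of `ℝ⁴`. -/
def halfPoints : Set (EuclideanSpace ℝ (Fin 4)) :=
  {x | ∀ i, |x i| = 1 / 2}

/-- The 96 points of `ℝ⁴` that arise from `(±φ, ±1, ±φ⁻¹, 0) / 2`, with `φ` the golden ratio,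
by even permutations of the coordinates. -/
def goldenPoints : Set (EuclideanSpace ℝ (Fin 4)) :=
  {x | ∃ σ ∈ alternatingGroup (Fin 4),
    |x (σ 0)| = Real.goldenRatio / 2 ∧ |x (σ 1)| = 1 / 2 ∧
    |x (σ 2)| = Real.goldenRatio⁻¹ / 2 ∧ x (σ 3) = 0}

/-- The standard regular cross-polytope `{3,3,4}` in `ℝ⁴`. -/
def crossPolytope4 : Set (EuclideanSpace ℝ (Fin 4)) :=
  convexHull ℝ axisPoints

/-- The standard regular 24-cell `{3,4,3}`. -/
def cell24 : Set (EuclideanSpace ℝ (Fin 4)) :=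
  convexHull ℝ (axisPoints ∪ halfPoints)

/-- The standard regular 600-cell `{3,3,5}`. -/
def cell600 : Set (EuclideanSpace ℝ (Fin 4)) :=
  convexHull ℝ (axisPoints ∪ halfPoints ∪ goldenPoints)

/-! Left quaternion multiplication is norm-multiplicative, so for `l ≠ 0` the map `x ↦ a + l x` is a
similarity of `ℝ⁴`. The images of the vertices `v i` under these maps thus fill a linear space `W`
of families, of dimension `2d = 8`, that contains the constant families. Sarkaria's argument
(`exists_partition_convexCombination_mem`) applies colourful Carathéodory in `(κ → E) ⧸ W` times
`ℝ^κ` modulo constants, of dimension `(rd - 2d) + (r - 1)`. Hence `(d + 1) r - 2d = 5r - 8` points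
split into classes with convex combinations `a + l (v i)`. The only failure is `l = 0`, where all
class hulls share a point. A parameter count (`addHaar_tverbergSet_eq_zero`) makes such tuples a
closed null set. With `r ≤ 8, 24, 120` the bounds follow. -/

open MeasureTheory Module

/-! ### Colourful Carathéodory -/

/-- If `x` lies strictly on the near side of the hyperplane through `y` orthogonal to `y`, then the
segment from `y` to `x` contains a point of norm smaller than that of `y`. -/
theorem exists_mem_segment_norm_lt {V : Type*} [NormedAddCommGroup V] [InnerProductSpace ℝ V]
    {x y : V} (h : inner ℝ y x < ‖y‖ ^ 2) : ∃ z ∈ segment ℝ y x, ‖z‖ < ‖y‖ := by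
  set a : ℝ := ‖y‖ ^ 2 - inner ℝ y x with ha
  have hapos : 0 < a := sub_pos.2 h
  set D : ℝ := ‖x - y‖ ^ 2 with hD
  have hD0 : 0 ≤ D := sq_nonneg _
  -- The squared norm at parameter `t` is `‖y‖² - 2ta + t²D`. The extra `a` in the denominator keeps
  -- `t ≤ 1` and allows `D = 0`.
  set t : ℝ := a / (D + a) with ht
  have htpos : 0 < t := by positivity
  have ht1 : t ≤ 1 := by rw [ht, div_le_one (by positivity)]; linarith
  have htD : t * (D + a) = a := by rw [ht]; field_simp
  refine ⟨y + t • (x - y), ?_, ?_⟩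
  · rw [segment_eq_image']
    exact ⟨t, ⟨htpos.le, ht1⟩, rfl⟩
  · refine lt_of_pow_lt_pow_left₀ 2 (norm_nonneg _) ?_
    have e : inner ℝ y (x - y) = -a := by
      rw [inner_sub_right, real_inner_self_eq_norm_sq]; ring
    rw [norm_add_sq_real, inner_smul_right, e, norm_smul, mul_pow, Real.norm_eq_abs, sq_abs, ← hD]
    nlinarith [mul_pos htpos hapos, mul_pos (mul_pos htpos hapos) htpos]

/-- A point of a convex hull minimising the norm, if nonzero, is a convex combination of at most
`finrank ℝ V` of the given points. -/
theorem exists_mem_convexHull_image_of_norm_le {V ι : Type*} [NormedAddCommGroup V]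
    [InnerProductSpace ℝ V] [FiniteDimensional ℝ V] {u : ι → V} {y : V} (hy0 : y ≠ 0)
    (hy : y ∈ convexHull ℝ (Set.range u)) (hmin : ∀ x ∈ convexHull ℝ (Set.range u), ‖y‖ ≤ ‖x‖) :
    ∃ T : Finset ι, T.card ≤ finrank ℝ V ∧ y ∈ convexHull ℝ (u '' T) := by
  classical
  have hinner : ∀ x ∈ convexHull ℝ (Set.range u), ‖y‖ ^ 2 ≤ inner ℝ y x := by
    intro x hx
    by_contra! hlt
    obtain ⟨z, hz, hzy⟩ := exists_mem_segment_norm_lt hlt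
    exact absurd (hmin z ((convex_convexHull ℝ _).segment_subset hy hx hz)) (not_le.2 hzy)
  obtain ⟨κ, _, z, w, hz, hind, hw, hw1, hwz⟩ := eq_pos_convex_span_of_mem_convexHull hy
  have hzhull : ∀ k, ‖y‖ ^ 2 ≤ inner ℝ y (z k) := fun k =>
    hinner _ (subset_convexHull ℝ _ (hz ⟨k, rfl⟩))
  -- All `z k` lie beyond the supporting hyperplane at `y` and their positive average lies on it, so
  -- each lies on it. This hyperplane misses the origin, which upgrades affine to linear
  -- independence.
  have hsum : ∑ k, w k * (inner ℝ y (z k) - ‖y‖ ^ 2) = 0 := by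
    simp_rw [mul_sub, Finset.sum_sub_distrib, ← Finset.sum_mul, hw1, ← inner_smul_right,
      ← inner_sum, hwz, real_inner_self_eq_norm_sq]
    ring
  have hzeq : ∀ k, inner ℝ y (z k) = ‖y‖ ^ 2 := by
    intro k
    have := (Finset.sum_eq_zero_iff_of_nonneg fun k _ =>
      mul_nonneg (hw k).le (sub_nonneg.2 (hzhull k))).1 hsum k (Finset.mem_univ k)
    rcases mul_eq_zero.1 this with h | h
    · exact absurd h (hw k).ne'
    · linarith
  have hlin : LinearIndependent ℝ z := by
    rw [Fintype.linearIndependent_iff]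
    intro c hc
    have hcsum : ∑ k, c k = 0 := by
      have h1 : inner ℝ y (∑ k, c k • z k) = (∑ k, c k) * ‖y‖ ^ 2 := by
        simp_rw [inner_sum, inner_smul_right, hzeq, Finset.sum_mul]
      rw [hc, inner_zero_right] at h1
      exact (mul_eq_zero.1 h1.symm).resolve_right (by positivity)
    intro k
    exact (affineIndependent_iff.1 hind) Finset.univ c hcsum hc k (Finset.mem_univ k)
  choose i hi using fun k => hz ⟨k, rfl⟩
  refine ⟨Finset.univ.image i, Finset.card_image_le.trans hlin.fintype_card_le_finrank, ?_⟩
  rw [← hwz]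
  refine (convex_convexHull ℝ _).sum_mem (fun k _ => (hw k).le) hw1 fun k _ => ?_
  refine subset_convexHull ℝ _ ⟨i k, by simp, hi k⟩

/-- **Bárány's colourful Carathéodory theorem**, in an inner product space. -/
theorem colorful_caratheodory_inner {V ι κ : Type*} [NormedAddCommGroup V]
    [InnerProductSpace ℝ V] [FiniteDimensional ℝ V] [Fintype ι] [Finite κ] (v : ι → κ → V)
    (hcard : finrank ℝ V < Fintype.card ι) (h0 : ∀ i, 0 ∈ convexHull ℝ (Set.range (v i))) :
    ∃ s : ι → κ, 0 ∈ convexHull ℝ (Set.range fun i => v i (s i)) := by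
  classical
  have : Nonempty ι := Fintype.card_pos_iff.1 (by omega)
  have hκ : Nonempty κ := by
    have := (convexHull_nonempty_iff.1 ⟨0, h0 (Classical.arbitrary ι)⟩)
    exact Set.range_nonempty_iff_nonempty.1 this
  set K : Set V := ⋃ s : ι → κ, convexHull ℝ (Set.range fun i => v i (s i)) with hK
  have hKc : IsCompact K := isCompact_iUnion fun s => (Set.finite_range _).isCompact_convexHull ℝ
  have hKn : K.Nonempty := by
    refine ⟨v (Classical.arbitrary ι) (Classical.arbitrary κ), Set.mem_iUnion.2
      ⟨fun _ => Classical.arbitrary κ, subset_convexHull ℝ _ ⟨_, rfl⟩⟩⟩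
  obtain ⟨y, hyK, hymin⟩ := hKc.exists_isMinOn hKn continuous_norm.continuousOn
  obtain ⟨s, hs⟩ := Set.mem_iUnion.1 hyK
  refine ⟨s, ?_⟩
  by_cases hy0 : y = 0
  · exact hy0 ▸ hs
  exfalso
  obtain ⟨T, hT, hyT⟩ := exists_mem_convexHull_image_of_norm_le hy0 hs fun x hx =>
    hymin (Set.mem_iUnion.2 ⟨s, hx⟩)
  -- Some colour is not needed to represent `y`; exchanging its point for one not beyond the
  -- supporting hyperplane lowers the minimum.
  obtain ⟨i₀, hi₀⟩ : ∃ i, i ∉ T := by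
    by_contra! h
    have := Finset.card_le_card (fun i _ => h i : (Finset.univ : Finset ι) ⊆ T)
    rw [Finset.card_univ] at this
    omega
  obtain ⟨g, hg⟩ : ∃ g, inner ℝ y (v i₀ g) ≤ 0 := by
    by_contra! h
    have hsub : convexHull ℝ (Set.range (v i₀)) ⊆ {x | 0 < inner ℝ y x} := by
      refine convexHull_min ?_ (convex_halfSpace_gt (innerSL ℝ y).toLinearMap.isLinear 0)
      rintro _ ⟨g, rfl⟩
      exact h g
    simpa using hsub (h0 i₀)
  obtain ⟨z, hz, hzy⟩ := exists_mem_segment_norm_lt (x := v i₀ g) (y := y)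
    (hg.trans_lt (by positivity))
  set s' : ι → κ := Function.update s i₀ g with hs'
  have hy' : y ∈ convexHull ℝ (Set.range fun i => v i (s' i)) := by
    refine convexHull_mono ?_ hyT
    rintro _ ⟨i, hi, rfl⟩
    have : i ≠ i₀ := by rintro rfl; exact hi₀ hi
    exact ⟨i, by simp [hs', this]⟩
  have hg' : v i₀ g ∈ convexHull ℝ (Set.range fun i => v i (s' i)) :=
    subset_convexHull ℝ _ ⟨i₀, by simp [hs']⟩
  exact absurd (hymin (Set.mem_iUnion.2 ⟨s', (convex_convexHull ℝ _).segment_subset hy' hg' hz⟩))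
    (not_le.2 hzy)

/-- **Bárány's colourful Carathéodory theorem** in a finite-dimensional real vector space. -/
theorem colorful_caratheodory {V ι κ : Type*} [AddCommGroup V] [Module ℝ V]
    [FiniteDimensional ℝ V] [Fintype ι] [Finite κ] (v : ι → κ → V)
    (hcard : finrank ℝ V < Fintype.card ι) (h0 : ∀ i, 0 ∈ convexHull ℝ (Set.range (v i))) :
    ∃ s : ι → κ, 0 ∈ convexHull ℝ (Set.range fun i => v i (s i)) := by
  obtain ⟨e⟩ := FiniteDimensional.nonempty_linearEquiv_of_finrank_eq (R := ℝ) (M := V)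
    (M' := EuclideanSpace ℝ (Fin (finrank ℝ V))) (by simp)
  have key : ∀ A : Set V, 0 ∈ convexHull ℝ (e '' A) ↔ 0 ∈ convexHull ℝ A := by
    intro A
    have h := e.toLinearMap.image_convexHull A
    rw [LinearEquiv.coe_coe] at h
    rw [← h]
    simp
  obtain ⟨s, hs⟩ := colorful_caratheodory_inner (fun i g => e (v i g)) (by simpa using hcard)
    fun i => by
      simpa only [← Set.range_comp] using! (key _).2 (h0 i)
  exact ⟨s, (key _).1 (by simpa only [← Set.range_comp] using! hs)⟩

/-! ### Sarkaria's argument -/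

theorem exists_weights_of_mem_convexHull_range {E ι : Type*} [AddCommGroup E] [Module ℝ E]
    [Fintype ι] {u : ι → E} {x : E} (hx : x ∈ convexHull ℝ (Set.range u)) :
    ∃ w : ι → ℝ, (∀ j, 0 ≤ w j) ∧ ∑ j, w j = 1 ∧ ∑ j, w j • u j = x := by
  classical
  have h : Set.range u = Fintype.linearCombination ℝ u '' Set.range fun i => Pi.single i 1 := by
    rw [← Set.range_comp]
    congr 1
    ext i
    simp
  rw [h, ← LinearMap.image_convexHull, convexHull_rangle_single_eq_stdSimplex] at hx
  obtain ⟨w, hw, rfl⟩ := hx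
  exact ⟨w, hw.1, hw.2, (Fintype.linearCombination_apply ..).symm⟩

theorem sum_smul_single_eq_sum_filter {M ι κ : Type*} [AddCommGroup M] [Module ℝ M] [Fintype ι]
    [DecidableEq κ] (s : ι → κ) (w : ι → ℝ) (q : ι → M) :
    ∑ j, w j • (Pi.single (s j) (q j) : κ → M) = fun i => ∑ j with s j = i, w j • q j := by
  ext i
  rw [Finset.sum_apply, Finset.sum_filter]
  refine Finset.sum_congr rfl fun j _ => ?_
  by_cases h : s j = i
  · subst h; simp
  · simp [h, Ne.symm h]

/-- A Tverberg-type theorem, by Sarkaria's argument. Let `W` be a space of families `κ → E`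
containing the constant ones. Any sufficiently large family of points of `E` can be
partitioned into classes indexed by `κ`, so that some choice of convex combinations of the
classes lies in `W`. -/
theorem exists_partition_convexCombination_mem {E ι κ : Type*} [AddCommGroup E] [Module ℝ E]
    [FiniteDimensional ℝ E] [Fintype ι] [Fintype κ] [Nonempty κ] [DecidableEq κ]
    (W : Submodule ℝ (κ → E)) (hW : ∀ a : E, (fun _ => a) ∈ W) (p : ι → E)
    (hcard : Fintype.card κ * (finrank ℝ E + 1) ≤ Fintype.card ι + finrank ℝ W) :
    ∃ (s : ι → κ) (w : ι → ℝ), (∀ j, 0 ≤ w j) ∧ (∀ i, ∑ j with s j = i, w j = 1) ∧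
      (fun i => ∑ j with s j = i, w j • p j) ∈ W := by
  classical
  -- Vanishing modulo the constants `C` forces all classes to carry the same total weight.
  set C : Submodule ℝ (κ → ℝ) := Submodule.span ℝ {1} with hC
  have hC1 : finrank ℝ C = 1 := finrank_span_singleton one_ne_zero
  have hr : (0 : ℝ) < Fintype.card κ := by exact_mod_cast Fintype.card_pos
  have hdim : finrank ℝ (((κ → E) ⧸ W) × ((κ → ℝ) ⧸ C)) < Fintype.card ι := by
    have h1 := W.finrank_quotient_add_finrank
    have h2 := C.finrank_quotient_add_finrank
    rw [finrank_pi_fintype, Finset.sum_const, Finset.card_univ, smul_eq_mul] at h1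
    rw [finrank_pi, hC1] at h2
    rw [finrank_prod]
    rw [mul_add, mul_one] at hcard
    omega
  let v : ι → κ → ((κ → E) ⧸ W) × ((κ → ℝ) ⧸ C) := fun j i =>
    (W.mkQ (Pi.single i (p j)), C.mkQ (Pi.single i 1))
  have h0 : ∀ j, 0 ∈ convexHull ℝ (Set.range (v j)) := by
    intro j
    -- The copies of `p j` in all places add up to a constant family, which dies in both quotients.
    have hsum : ∑ i, (Fintype.card κ : ℝ)⁻¹ • v j i = 0 := by
      have hE : W.mkQ (∑ i, Pi.single i (p j)) = 0 := by
        rw [Finset.univ_sum_single fun _ => p j, Submodule.mkQ_apply, Submodule.Quotient.mk_eq_zero]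
        exact hW (p j)
      have hR : C.mkQ (∑ i, Pi.single i 1) = 0 := by
        rw [Finset.univ_sum_single fun _ => (1 : ℝ), Submodule.mkQ_apply,
          Submodule.Quotient.mk_eq_zero]
        exact Submodule.mem_span_singleton_self _
      rw [map_sum] at hE hR
      rw [← Finset.smul_sum, Prod.ext_iff, Prod.smul_fst, Prod.smul_snd, Prod.fst_sum,
        Prod.snd_sum, hE, hR]
      simp
    rw [← hsum]
    exact (convex_convexHull ℝ _).sum_mem (fun _ _ => by positivity) (by simp [hr.ne'])
      fun i _ => subset_convexHull ℝ _ ⟨i, rfl⟩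
  obtain ⟨s, hs⟩ := colorful_caratheodory v hdim h0
  obtain ⟨w, hw0, hw1, hw⟩ := exists_weights_of_mem_convexHull_range hs
  rw [Prod.ext_iff, Prod.fst_sum, Prod.snd_sum] at hw
  have hwE : W.mkQ (∑ j, w j • Pi.single (s j) (p j)) = 0 := by
    simpa only [map_sum, map_smul] using! hw.1
  have hwR : C.mkQ (∑ j, w j • Pi.single (s j) 1) = 0 := by
    simpa only [map_sum, map_smul] using! hw.2
  rw [sum_smul_single_eq_sum_filter, Submodule.mkQ_apply, Submodule.Quotient.mk_eq_zero] at hwE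
  rw [sum_smul_single_eq_sum_filter s w fun _ => (1 : ℝ), Submodule.mkQ_apply,
    Submodule.Quotient.mk_eq_zero] at hwR
  obtain ⟨c, hc⟩ := Submodule.mem_span_singleton.1 hwR
  have hc' : ∀ i, ∑ j with s j = i, w j = c := by
    intro i
    simpa using (congrFun hc i).symm
  have hcr : Fintype.card κ * c = 1 := by
    rw [← hw1, ← Finset.sum_fiberwise (s := Finset.univ) (g := s),
      Finset.sum_congr rfl fun i _ => hc' i]
    simp
  -- Each class has weight `1 / r`, with `r = Fintype.card κ`; multiplying by `r` normalises it.
  refine ⟨s, fun j => Fintype.card κ * w j, fun j => mul_nonneg hr.le (hw0 j), fun i => ?_, ?_⟩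
  · rw [← Finset.mul_sum, hc', hcr]
  · have := W.smul_mem (Fintype.card κ : ℝ) hwE
    convert this using 2 with i
    simp [Finset.smul_sum, mul_smul]

/-! ### Degenerate tuples form a closed null set -/

/-- The range of a `C¹` map from a space of smaller dimension is a null set. -/
theorem ContDiff.addHaar_range_eq_zero {E F : Type*} [NormedAddCommGroup E] [NormedSpace ℝ E]
    [FiniteDimensional ℝ E] [NormedAddCommGroup F] [NormedSpace ℝ F] [FiniteDimensional ℝ F]
    [MeasurableSpace F] [BorelSpace F] (μ : Measure F) [μ.IsAddHaarMeasure] {f : E → F}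
    (hf : ContDiff ℝ 1 f) (hdim : finrank ℝ E < finrank ℝ F) : μ (Set.range f) = 0 := by
  have h : dimH (Set.range f) < ((finrank ℝ F : NNReal) : ENNReal) :=
    hf.dimH_range_le.trans_lt (by exact_mod_cast hdim)
  have h0 := hausdorffMeasure_of_dimH_lt h
  simp only [NNReal.coe_natCast] at h0
  exact Measure.absolutelyContinuous_isAddHaarMeasure μ (Measure.hausdorffMeasure (finrank ℝ F)) h0

section TverbergSet

variable {E ι κ : Type*} [NormedAddCommGroup E] [NormedSpace ℝ E] [Fintype ι] [DecidableEq κ]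

/-- The families of points for which the convex hulls of the classes `s ⁻¹' {i}` have a common
point. -/
def tverbergSet (s : ι → κ) : Set (ι → E) :=
  {p | ∃ w : ι → ℝ, (∀ j, 0 ≤ w j) ∧ (∀ i, ∑ j with s j = i, w j = 1) ∧
    ∀ i i', ∑ j with s j = i, w j • p j = ∑ j with s j = i', w j • p j}

/-- The weights range over a compact cube, and projection along a compact factor is closed. -/
theorem isClosed_tverbergSet (s : ι → κ) : IsClosed (tverbergSet s : Set (ι → E)) := by
  have h : (tverbergSet s : Set (ι → E)) = Prod.snd '' {x : (ι → unitInterval) × (ι → E) |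
      (∀ i, ∑ j with s j = i, (x.1 j : ℝ) = 1) ∧
      ∀ i i', ∑ j with s j = i, (x.1 j : ℝ) • x.2 j = ∑ j with s j = i', (x.1 j : ℝ) • x.2 j} := by
    ext p
    constructor
    · rintro ⟨w, hw0, hw1, hw⟩
      have hle : ∀ j, w j ≤ 1 := fun j => by
        rw [← hw1 (s j)]
        exact Finset.single_le_sum (f := w) (fun j _ => hw0 j) (by simp)
      exact ⟨(fun j => ⟨w j, hw0 j, hle j⟩, p), ⟨hw1, hw⟩, rfl⟩
    · rintro ⟨⟨w, p⟩, ⟨hw1, hw⟩, rfl⟩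
      exact ⟨fun j => w j, fun j => (w j).2.1, hw1, hw⟩
  rw [h]
  refine isClosedMap_snd_of_compactSpace _ ?_
  simp only [Set.ofPred_and, Set.ofPred_forall]
  refine IsClosed.inter (isClosed_iInter fun i => ?_)
    (isClosed_iInter fun i => isClosed_iInter fun i' => ?_)
  · exact isClosed_eq (by fun_prop) continuous_const
  · exact isClosed_eq (by fun_prop) (by fun_prop)

/-- If `t` is a section of `s : ι → κ`, this map sends a point `a` and points and
coefficients for the indices outside the range of `t` to the family of points in which `a` is the
affine combination of every class with the given coefficients, the coefficient of `t i` being `1`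
before normalisation. -/
noncomputable def familyOfAffineCombination [DecidableEq ι] (s : ι → κ) (t : κ → ι)
    (x : E × ({j // t (s j) ≠ j} → ℝ) × ({j // t (s j) ≠ j} → E)) (j : ι) : E :=
  if h : t (s j) = j then x.1 + ∑ k with s k.1 = s j, x.2.1 k • (x.1 - x.2.2 k) else x.2.2 ⟨j, h⟩

theorem contDiff_familyOfAffineCombination [DecidableEq ι] (s : ι → κ) (t : κ → ι) :
    ContDiff ℝ 1 (familyOfAffineCombination (E := E) s t) := by
  rw [contDiff_pi]
  intro j
  unfold familyOfAffineCombination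
  by_cases h : t (s j) = j
  · simp only [h, dite_true]
    fun_prop
  · simp only [h, dite_false]
    fun_prop

/-- In each class, choose a point of nonzero weight and solve for it in terms of the common point,
the other points and the weight ratios. -/
theorem tverbergSet_subset [DecidableEq ι] (s : ι → κ) [Nonempty κ] :
    (tverbergSet s : Set (ι → E)) ⊆
    ⋃ t ∈ {t : κ → ι | ∀ i, s (t i) = i}, Set.range (familyOfAffineCombination s t) := by
  classical
  rintro p ⟨w, hw0, hw1, hw⟩
  have hex : ∀ i, ∃ j, s j = i ∧ w j ≠ 0 := by
    intro i
    by_contra! h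
    have := hw1 i
    rw [Finset.sum_eq_zero fun j hj => h j (by simpa using hj)] at this
    exact zero_ne_one this
  choose t hts ht0 using hex
  let a : E := ∑ j with s j = Classical.arbitrary κ, w j • p j
  have ha : ∀ i, ∑ j with s j = i, w j • p j = a := fun i => hw _ _
  refine Set.mem_iUnion₂.2 ⟨t, hts, (a, fun k => w k / w (t (s k)), fun k => p k), ?_⟩
  ext1 j
  unfold familyOfAffineCombination
  split_ifs with h
  · have hj0 : w j ≠ 0 := h ▸ ht0 (s j)
    have hsum : ∑ k : {k // t (s k) ≠ k} with s k.1 = s j, w k • (a - p k) =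
        -(w j • (a - p j)) := by
      have h1 : ∑ k with s k = s j, w k • (a - p k) = 0 := by
        simp_rw [smul_sub, Finset.sum_sub_distrib, ← Finset.sum_smul, hw1, ha]
        simp
      have h2 : ∑ k : {k // t (s k) ≠ k} with s k.1 = s j, w k • (a - p k) =
          ∑ k ∈ (Finset.univ.filter fun k => s k = s j).erase j, w k • (a - p k) := by
        refine Finset.sum_nbij Subtype.val ?_ Subtype.val_injective.injOn ?_ fun _ _ => rfl
        · rintro ⟨k, hk⟩ hks
          have hks' : s k = s j := by simpa using hks
          simp only [Finset.mem_erase, Finset.mem_filter, Finset.mem_univ, true_and]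
          exact ⟨fun hkj => hk (by rw [hkj, h]), hks'⟩
        · intro k hk
          simp only [Finset.coe_erase, Finset.coe_filter, Finset.mem_univ, true_and] at hk
          have hks : s k = s j := hk.1
          exact ⟨⟨k, by rw [hks, h]; exact fun e => hk.2 e.symm⟩, by simpa using hks, rfl⟩
      rw [h2, eq_neg_iff_add_eq_zero, Finset.sum_erase_add _ _ (by simp), h1]
    have hsum' : ∑ k : {k // t (s k) ≠ k} with s k.1 = s j, (w k / w (t (s k))) • (a - p k) =
        (w j)⁻¹ • ∑ k : {k // t (s k) ≠ k} with s k.1 = s j, w k • (a - p k) := by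
      rw [Finset.smul_sum]
      refine Finset.sum_congr rfl fun k hk => ?_
      rw [(Finset.mem_filter.1 hk).2, h, smul_smul, div_eq_inv_mul]
    simp only [hsum', hsum]
    rw [smul_neg, inv_smul_smul₀ hj0]
    abel
  · rfl

/-- With `N` points, `r` classes and `d = finrank ℝ E`, there are `d + (N - r)(d + 1)` parameters;
`hcard` says that this is less than `N d`. -/
theorem addHaar_tverbergSet_eq_zero [FiniteDimensional ℝ E] [MeasurableSpace E] [BorelSpace E]
    (μ : Measure (ι → E)) [μ.IsAddHaarMeasure] [Fintype κ] [Nonempty κ] (s : ι → κ)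
    (hcard : Fintype.card ι + finrank ℝ E < (finrank ℝ E + 1) * Fintype.card κ) :
    μ (tverbergSet s) = 0 := by
  classical
  refine measure_mono_null (tverbergSet_subset s) ?_
  refine (measure_biUnion_null_iff (Set.to_countable _)).2 fun t ht => ?_
  refine (contDiff_familyOfAffineCombination s t).addHaar_range_eq_zero μ ?_
  have hc : Fintype.card {j // t (s j) ≠ j} + Fintype.card κ = Fintype.card ι := by
    have h1 := Fintype.card_subtype_compl fun j => t (s j) = j
    have h2 : Fintype.card {j // t (s j) = j} = Fintype.card κ :=
      Fintype.card_congr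
        { toFun := fun j => s j
          invFun := fun i => ⟨t i, by rw [ht i]⟩
          left_inv := fun j => Subtype.ext j.2
          right_inv := fun i => ht i }
    have h3 := Fintype.card_subtype_le fun j => t (s j) = j
    simp only [ne_eq]
    omega
  simp only [finrank_prod, finrank_pi_fintype, finrank_self, Finset.sum_const, Finset.card_univ,
    smul_eq_mul]
  rw [← hc] at hcard ⊢
  nlinarith

end TverbergSet

/-! ### Similarities from a norm-multiplicative product -/

/-- Every subset of a sphere is the set of extreme points of its convex hull. -/
theorem extremePoints_convexHull_of_subset_sphere {E : Type*} [NormedAddCommGroup E]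
    [NormedSpace ℝ E] [StrictConvexSpace ℝ E] {S : Set E} {a : E} {R : ℝ} (hR : R ≠ 0)
    (hS : S ⊆ Metric.sphere a R) : Set.extremePoints ℝ (convexHull ℝ S) = S := by
  refine extremePoints_convexHull_subset.antisymm fun x hx => ?_
  exact inter_extremePoints_subset_extremePoints_of_subset
    (convexHull_min (hS.trans Metric.sphere_subset_closedBall) (convex_closedBall a R))
    ⟨subset_convexHull ℝ S hx,
      StrictConvexSpace.sphere_subset_extremePoints_closedBall a hR (hS hx)⟩

section Multiplication

variable {E : Type*} [NormedAddCommGroup E] [InnerProductSpace ℝ E]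

/-- The similarities `x ↦ a + l * x`, restricted to a family of points. -/
def affineFamilies {κ : Type*} (mul : E →ₗ[ℝ] E →ₗ[ℝ] E) (v : κ → E) : E × E →ₗ[ℝ] κ → E :=
  LinearMap.pi fun i => LinearMap.fst ℝ E E + (mul.flip (v i)).comp (LinearMap.snd ℝ E E)

theorem affineFamilies_apply {κ : Type*} (mul : E →ₗ[ℝ] E →ₗ[ℝ] E) (v : κ → E) (a l : E) :
    affineFamilies mul v (a, l) = fun i => a + mul l (v i) := rfl

theorem injective_of_norm_mul {mul : E →ₗ[ℝ] E →ₗ[ℝ] E} (hmul : ∀ l x, ‖mul l x‖ = ‖l‖ * ‖x‖)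
    {l : E} (hl : l ≠ 0) : Function.Injective (mul l) := by
  rw [injective_iff_map_eq_zero]
  intro x hx
  have h := hmul l x
  rw [hx, norm_zero] at h
  exact norm_eq_zero.1 ((mul_eq_zero.1 h.symm).resolve_left (norm_ne_zero_iff.2 hl))

theorem affineFamilies_injective {κ : Type*} {mul : E →ₗ[ℝ] E →ₗ[ℝ] E}
    (hmul : ∀ l x, ‖mul l x‖ = ‖l‖ * ‖x‖) {v : κ → E} {i i' : κ} (hv : v i ≠ v i') :
    Function.Injective (affineFamilies mul v) := by
  rw [injective_iff_map_eq_zero]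
  rintro ⟨a, l⟩ h
  rw [affineFamilies_apply] at h
  have h1 : a + mul l (v i) = 0 := congrFun h i
  have h2 : a + mul l (v i') = 0 := congrFun h i'
  have hl : l = 0 := by
    by_contra hl
    exact hv (injective_of_norm_mul hmul hl (add_left_cancel (h1.trans h2.symm)))
  subst hl
  simpa using h1

end Multiplication

/-- Multiplication by `l / ‖l‖` is a linear isometry, onto by equality of dimensions; the scaling
factor is `‖l‖`. -/
theorem areSimilar_image_mul {d : ℕ}
    {mul : EuclideanSpace ℝ (Fin d) →ₗ[ℝ] EuclideanSpace ℝ (Fin d) →ₗ[ℝ] EuclideanSpace ℝ (Fin d)}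
    (hmul : ∀ l x, ‖mul l x‖ = ‖l‖ * ‖x‖) (a : EuclideanSpace ℝ (Fin d))
    {l : EuclideanSpace ℝ (Fin d)} (hl : l ≠ 0) (P : Set (EuclideanSpace ℝ (Fin d))) :
    AreSimilar P ((fun x => a + mul l x) '' P) := by
  have hl' : ‖l‖ ≠ 0 := norm_ne_zero_iff.2 hl
  let g : EuclideanSpace ℝ (Fin d) →ₗᵢ[ℝ] EuclideanSpace ℝ (Fin d) :=
    ⟨mul (‖l‖⁻¹ • l), fun x => by simp [hmul, norm_smul, hl']⟩
  refine ⟨(g.toLinearIsometryEquiv rfl).toIsometryEquiv.trans (IsometryEquiv.addLeft a), ‖l‖,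
    norm_pos_iff.2 hl, ?_⟩
  refine Set.image_congr fun x _ => ?_
  change a + mul l x = a + mul (‖l‖⁻¹ • l) (‖l‖ • x)
  simp [smul_smul, hl']

/-- In the presence of a multiplication on `ℝ^d` with multiplicative norm, a generic set of
`(d + 1) r - 2 d` points can be partitioned by a polytope similar to a given one with `r` vertices
on the unit sphere. -/
theorem holdsGenerically_canBePartitioned {d N r : ℕ}
    {mul : EuclideanSpace ℝ (Fin d) →ₗ[ℝ] EuclideanSpace ℝ (Fin d) →ₗ[ℝ] EuclideanSpace ℝ (Fin d)}
    (hmul : ∀ l x, ‖mul l x‖ = ‖l‖ * ‖x‖) (hd : 0 < d) {v : Fin r → EuclideanSpace ℝ (Fin d)}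
    (hv : Function.Injective v) (hnorm : ∀ i, ‖v i‖ = 1) (hr : 2 ≤ r)
    (hN : N + 2 * d = (d + 1) * r) :
    HoldsGenerically (fun p : Fin N → EuclideanSpace ℝ (Fin d) =>
      ∃ Q, AreSimilar (convexHull ℝ (Set.range v)) Q ∧ CanBePartitioned Q p) := by
  have : Nonempty (Fin r) := ⟨⟨0, by omega⟩⟩
  set B : Set (Fin N → EuclideanSpace ℝ (Fin d)) := ⋃ s : Fin N → Fin r, tverbergSet s
  have hB0 : volume B = 0 := measure_iUnion_null fun s =>
    addHaar_tverbergSet_eq_zero (E := EuclideanSpace ℝ (Fin d)) volume s (by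
      simp only [Fintype.card_fin, finrank_euclideanSpace (𝕜 := ℝ)]
      omega)
  refine ⟨Bᶜ, (isClosed_iUnion_of_finite fun s => isClosed_tverbergSet s).isOpen_compl,
    interior_eq_empty_iff_dense_compl.1 (Measure.interior_eq_empty_of_null hB0),
    by rwa [compl_compl], fun p hp => ?_⟩
  have hinj : Function.Injective (affineFamilies mul v) :=
    affineFamilies_injective hmul (i := ⟨0, by omega⟩) (i' := ⟨1, by omega⟩) fun h => by
      simpa using hv h
  have hrank := LinearMap.finrank_range_of_inj hinj
  obtain ⟨s, w, hw0, hw1, ⟨a, l⟩, hal⟩ := exists_partition_convexCombination_mem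
    (LinearMap.range (affineFamilies mul v)) (fun a => ⟨(a, 0), by simp [affineFamilies_apply]⟩) p
    (by rw [hrank]; simp; linarith)
  rw [affineFamilies_apply] at hal
  have hal' : ∀ i, ∑ j with s j = i, w j • p j = a + mul l (v i) := fun i => (congrFun hal i).symm
  -- If `l = 0`, all class combinations equal `a`, so `p` would lie in the excluded set `B`.
  have hl : l ≠ 0 := by
    rintro rfl
    exact hp (Set.mem_iUnion.2 ⟨s, w, hw0, hw1, fun i i' => by simp [hal']⟩)
  refine ⟨_, areSimilar_image_mul hmul a hl _, r, fun i => s ⁻¹' {i}, fun i => a + mul l (v i),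
    fun i i' hii' => Disjoint.preimage s (by simpa using hii'), ?_, fun i => ?_, ?_, ?_⟩
  · rw [← Set.preimage_iUnion, Set.iUnion_of_singleton, Set.preimage_univ]
  · beta_reduce
    rw [← hal']
    exact (convex_convexHull ℝ _).sum_mem (fun j _ => hw0 j) (hw1 i) fun j hj =>
      subset_convexHull ℝ _ ⟨j, by simpa using hj, rfl⟩
  · exact fun i i' h => hv (injective_of_norm_mul hmul hl (add_left_cancel h))
  · have himage : (fun x => a + mul l x) '' convexHull ℝ (Set.range v) =
        convexHull ℝ (Set.range fun i => a + mul l (v i)) := by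
      have h := (AffineMap.const ℝ _ a + (mul l).toAffineMap).image_convexHull (Set.range v)
      rw [← Set.range_comp] at h
      exact h
    rw [himage, extremePoints_convexHull_of_subset_sphere (norm_ne_zero_iff.2 hl) (a := a)]
    rintro _ ⟨i, rfl⟩
    simp [hmul, hnorm]

/-- Quaternion multiplication, as a bilinear map on `ℝ⁴`. -/
noncomputable def quaternionMul :
    EuclideanSpace ℝ (Fin 4) →ₗ[ℝ] EuclideanSpace ℝ (Fin 4) →ₗ[ℝ] EuclideanSpace ℝ (Fin 4) :=
  let e := Quaternion.linearIsometryEquivTuple.toLinearEquiv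
  ((LinearMap.mul ℝ (Quaternion ℝ)).compl₁₂ e.symm.toLinearMap e.symm.toLinearMap).compr₂
    e.toLinearMap

theorem norm_quaternionMul (l x : EuclideanSpace ℝ (Fin 4)) :
    ‖quaternionMul l x‖ = ‖l‖ * ‖x‖ := by
  change ‖Quaternion.linearIsometryEquivTuple (Quaternion.linearIsometryEquivTuple.symm l *
    Quaternion.linearIsometryEquivTuple.symm x)‖ = _
  simp [-Quaternion.linearIsometryEquivTuple_apply, -Quaternion.linearIsometryEquivTuple_symm_apply]

/-- A generic set of `5 r - 8` points of `ℝ⁴` can be partitioned by a polytope similar to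
the convex hull of `r` points of the unit sphere. -/
theorem partitionNumber_convexHull_le {S : Set (EuclideanSpace ℝ (Fin 4))} (hS : S.Finite)
    (hnorm : ∀ x ∈ S, ‖x‖ = 1) (hnt : S.Nontrivial) {n N : ℕ} (hn : S.ncard ≤ n)
    (hN : 5 * n ≤ N + 8) : partitionNumber (convexHull ℝ S) ≤ N := by
  have hfin : Finite S := hS
  rw [← Nat.card_coe_set_eq] at hn
  have hr : 2 ≤ Nat.card S := by
    rw [Nat.card_coe_set_eq]
    exact (Set.one_lt_ncard hS).2 hnt
  let e := (Finite.equivFin S).symm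
  have hrange : Set.range (fun i => (e i : EuclideanSpace ℝ (Fin 4))) = S := by
    rw [Set.range_comp' (Subtype.val) e, e.surjective.range_eq, Set.image_univ, Subtype.range_coe]
  -- The subtraction is not truncated, as `Nat.card S ≥ 2`. The value grows with the number of
  -- vertices, so an upper bound `n` on that number suffices.
  have hgen := holdsGenerically_canBePartitioned (N := 5 * Nat.card S - 8) norm_quaternionMul
    (by simp) (v := fun i => (e i : EuclideanSpace ℝ (Fin 4)))
    (Subtype.val_injective.comp e.injective)
    (fun i => hnorm _ (e i).2) hr (by omega)
  rw [hrange] at hgen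
  have hle : partitionNumber (convexHull ℝ S) ≤ ((5 * Nat.card S - 8 : ℕ) : ℕ∞) :=
    sInf_le ⟨_, hgen, rfl⟩
  exact hle.trans (by exact_mod_cast (by omega))

/-! ### The vertices: unit norms and counts -/

theorem norm_of_mem_axisPoints {x : EuclideanSpace ℝ (Fin 4)} (hx : x ∈ axisPoints) :
    ‖x‖ = 1 := by
  obtain ⟨i, rfl | rfl⟩ := hx <;> simp

theorem norm_of_mem_halfPoints {x : EuclideanSpace ℝ (Fin 4)} (hx : x ∈ halfPoints) :
    ‖x‖ = 1 := by
  have h : ∀ i, x i ^ 2 = 1 / 4 := fun i => by rw [← sq_abs, hx i]; norm_num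
  rw [EuclideanSpace.norm_eq, Real.sqrt_eq_one]
  simp [h]

/-- Since `φ⁻¹ = -ψ` with `ψ` the conjugate, `φ² + φ⁻² = (φ + ψ) + 2 = 3`, so the squared norm is
`(3 + 1) / 4`. -/
theorem norm_of_mem_goldenPoints {x : EuclideanSpace ℝ (Fin 4)} (hx : x ∈ goldenPoints) :
    ‖x‖ = 1 := by
  obtain ⟨σ, -, h0, h1, h2, h3⟩ := hx
  rw [EuclideanSpace.norm_eq, Real.sqrt_eq_one, ← Equiv.sum_comp σ]
  simp only [Real.norm_eq_abs, Fin.sum_univ_four, h0, h1, h2, h3, Real.inv_goldenRatio, abs_zero]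
  have e1 := Real.goldenRatio_sq
  have e2 := Real.goldenConj_sq
  have e3 := Real.goldenRatio_add_goldenConj
  nlinarith

theorem ncard_le_of_subset_range {α β : Type*} [Finite α] {S : Set β} {n : ℕ} (f : α → β)
    (h : S ⊆ Set.range f) (hn : Nat.card α ≤ n) : S.Finite ∧ S.ncard ≤ n := by
  refine ⟨(Set.finite_range f).subset h, (Set.ncard_le_ncard h (Set.finite_range f)).trans ?_⟩
  rw [← Set.image_univ]
  exact (Set.ncard_image_le Set.finite_univ).trans (by rwa [Set.ncard_univ])

/-- The real sign of a Boolean. -/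
def boolSign (b : Bool) : ℝ := cond b 1 (-1)

theorem exists_eq_boolSign_mul_abs (x : ℝ) : ∃ b, x = boolSign b * |x| := by
  rcases abs_choice x with h | h
  · exact ⟨true, by simp [boolSign, h]⟩
  · exact ⟨false, by simp [boolSign, h]⟩

theorem ncard_axisPoints_le : axisPoints.Finite ∧ axisPoints.ncard ≤ 8 := by
  refine ncard_le_of_subset_range
    (fun x : Fin 4 × Bool => EuclideanSpace.single x.1 (boolSign x.2)) ?_ (by simp)
  rintro _ ⟨i, rfl | rfl⟩
  · exact ⟨(i, true), rfl⟩
  · exact ⟨(i, false), rfl⟩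

theorem ncard_halfPoints_le : halfPoints.Finite ∧ halfPoints.ncard ≤ 16 := by
  refine ncard_le_of_subset_range
    (fun b : Fin 4 → Bool => WithLp.toLp 2 fun i => boolSign (b i) * (1 / 2)) ?_ (by simp)
  intro x hx
  choose b hb using fun i => exists_eq_boolSign_mul_abs (x i)
  refine ⟨b, ?_⟩
  ext i
  rw [hb i, hx i]

theorem ncard_goldenPoints_le : goldenPoints.Finite ∧ goldenPoints.ncard ≤ 96 := by
  refine ncard_le_of_subset_range
    (fun x : alternatingGroup (Fin 4) × Bool × Bool × Bool => WithLp.toLp 2 fun i =>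
      ![boolSign x.2.1 * (Real.goldenRatio / 2), boolSign x.2.2.1 * (1 / 2),
        boolSign x.2.2.2 * (Real.goldenRatio⁻¹ / 2), 0] ((x.1 : Equiv.Perm (Fin 4)).symm i)) ?_ ?_
  · rintro x ⟨σ, hσ, h0, h1, h2, h3⟩
    choose b hb using fun i => exists_eq_boolSign_mul_abs (x i)
    refine ⟨(⟨σ, hσ⟩, b (σ 0), b (σ 1), b (σ 2)), ?_⟩
    ext i
    obtain ⟨k, rfl⟩ := σ.surjective i
    simp only [Equiv.symm_apply_apply]
    rw [← h0, ← h1, ← h2, ← hb, ← hb, ← hb, ← h3]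
    fin_cases k <;> rfl
  -- `96 = 12 · 2³`: even permutations times three signs.
  · have : Nat.card (alternatingGroup (Fin 4)) = 12 := by
      rw [nat_card_alternatingGroup, Nat.card_fin]
      rfl
    simp only [Nat.card_prod, this, Nat.card_eq_fintype_card (α := Bool), Fintype.card_bool]
    norm_num

theorem nontrivial_axisPoints : axisPoints.Nontrivial := by
  refine ⟨_, ⟨0, Or.inl rfl⟩, _, ⟨0, Or.inr rfl⟩, fun h => ?_⟩
  have := congrArg (fun x : EuclideanSpace ℝ (Fin 4) => x 0) h
  norm_num at this

theorem theorem1p3 :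
    partitionNumber crossPolytope4 ≤ 32 ∧
    partitionNumber cell24 ≤ 112 ∧
    partitionNumber cell600 ≤ 592 := by
  obtain ⟨hfA, hA⟩ := ncard_axisPoints_le
  obtain ⟨hfH, hH⟩ := ncard_halfPoints_le
  obtain ⟨hfG, hG⟩ := ncard_goldenPoints_le
  have hAH := Set.ncard_union_le axisPoints halfPoints
  have hAHG := Set.ncard_union_le (axisPoints ∪ halfPoints) goldenPoints
  have hnAH : ∀ x ∈ axisPoints ∪ halfPoints, ‖x‖ = 1 := fun x hx =>
    hx.elim norm_of_mem_axisPoints norm_of_mem_halfPoints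
  have hntAH := nontrivial_axisPoints.mono (Set.subset_union_left (t := halfPoints))
  exact ⟨partitionNumber_convexHull_le hfA (fun x => norm_of_mem_axisPoints) nontrivial_axisPoints
      hA (by norm_num),
    partitionNumber_convexHull_le (hfA.union hfH) hnAH hntAH (hAH.trans (add_le_add hA hH))
      (by norm_num),
    partitionNumber_convexHull_le ((hfA.union hfH).union hfG)
      (fun x hx => hx.elim (hnAH x) norm_of_mem_goldenPoints)
      (hntAH.mono Set.subset_union_left)
      (hAHG.trans (add_le_add (hAH.trans (add_le_add hA hH)) hG)) (by norm_num)⟩
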